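/- Let $M$ be a compact connected $C^\infty$ Riemannian manifold (without boundary). For $a\in H_1(M,\mathbb Z)$ (singular homology) let $$l(a)=\inf_{[\gamma]=a} l(\gamma)\in[0,\infty],$$ where $\gamma$ runs over all closed loops $\gamma:[0,1]\to M$ (continuous, $\gamma(0)=\gamma(1)$) with homology class $a$, and $l(\gamma)=\int_\gamma ds_g\in[0,\infty]$ is the length of $\gamma$, i.e. its total variation with respect to the Riemannian distance ($=\infty$ if $\gamma$ is not rectifiable). Then $l(a)<\infty$ for every $a\in H_1(M,\mathbb Z)$, and the limit $$\|a\|=\lim_{n\to+\infty}\frac{l(n\cdot a)}{n}$$ exists and is finite for every $a\in H_1(M,\mathbb Z)$. It satisfies: (i) for $a\in H_1(M,\mathbb Z)$, $\|a\|=0$ if and only if $a$ is torsion; (ii) for $a\in H_1(M,\mathbb Z)$ and $n\in\mathbb Z$, $\|n\cdot a\|=|n|\,\|a\|$; (iii) for $a,b\in H_1(M,\mathbb Z)$, $\|a+b\|\le\|a\|+\|b\|$; (iv) for $a\in H_1(M,\mathbb Z)$, $\|a\|\le l(a)$. Moreover there is exactly one norm $\|\cdot\|$ on the real vector space $H_1(M,\mathbb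 R)=\mathbb R\otimes_{\mathbb Z}H_1(M,\mathbb Z)$ such that $\|\lambda\otimes a\|=|\lambda|\,\|a\|$ for all $\lambda\in\mathbb R$ and $a\in H_1(M,\mathbb Z)$. -/

import Mathlib

open CategoryTheory AlgebraicTopology Filter Topology Manifold Bundle
open scoped ENNReal NNReal ContDiff TensorProduct Simplicial

universe u

noncomputable section

/-- The singular chain complex of `X` with coefficients in `ℤ` (lifted to the universe of `X`). -/
abbrev integralSingularChains (X : Type u) [TopologicalSpace X] :
    ChainComplex AddCommGrpCat.{u} ℕ :=
  (TopCat.toSSet.obj (TopCat.of X)).chainComplex (AddCommGrpCat.of (ULift.{u} ℤ))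

/-- The first singular homology group `H₁(X, ℤ)`. -/
abbrev integralH1 (X : Type u) [TopologicalSpace X] : Type u :=
  (((singularHomologyFunctor AddCommGrpCat.{u} 1).obj
    (AddCommGrpCat.of (ULift.{u} ℤ))).obj (TopCat.of X) : AddCommGrpCat.{u})

/-- A loop `γ : [0, 1] → X`, seen as a singular `1`-simplex of `X`. -/
def loopSimplex {X : Type u} [TopologicalSpace X] {x : X} (γ : Path x x) :
    (TopCat.toSSet.obj (TopCat.of X)) _⦋1⦌ :=
  ((TopCat.of X).toSSetObjEquiv (.op ⦋1⦌)).symm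
    (γ.toContinuousMap.comp
      ⟨stdSimplexHomeomorphUnitInterval, stdSimplexHomeomorphUnitInterval.continuous⟩)

/-- The two end points of a loop coincide. -/
lemma loopSimplex_δ {X : Type u} [TopologicalSpace X] {x : X} (γ : Path x x) :
    (TopCat.toSSet.obj (TopCat.of X)).δ 0 (loopSimplex γ) =
      (TopCat.toSSet.obj (TopCat.of X)).δ 1 (loopSimplex γ) := by
  apply ((TopCat.of X).toSSetObjEquiv (.op ⦋0⦌)).injective
  ext z
  have hz : ∀ i : Fin 2, stdSimplex.map i.succAbove z = stdSimplex.vertex (i.succAbove 0) := by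
    intro i
    rw [Subsingleton.elim z (stdSimplex.vertex (0 : Fin 1)), stdSimplex.map_vertex]
  have h : ∀ i : Fin 2, (TopCat.of X).toSSetObjEquiv (.op ⦋0⦌)
      ((TopCat.toSSet.obj (TopCat.of X)).δ i (loopSimplex γ)) z =
        γ (stdSimplexHomeomorphUnitInterval (stdSimplex.map i.succAbove z)) := fun i => rfl
  rw [h, h, hz, hz]
  have h0 : stdSimplexHomeomorphUnitInterval (stdSimplex.vertex (0 : Fin 2)) = 0 := rfl
  have h1 : stdSimplexHomeomorphUnitInterval (stdSimplex.vertex (1 : Fin 2)) = 1 := rfl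
  rw [show (0 : Fin 2).succAbove (0 : Fin 1) = 1 from rfl,
    show (1 : Fin 2).succAbove (0 : Fin 1) = 0 from rfl, h0, h1, γ.source, γ.target]

/-- A loop is a singular `1`-cycle. -/
lemma loopSimplex_d {X : Type u} [TopologicalSpace X] {x : X} (γ : Path x x) :
    (TopCat.toSSet.obj (TopCat.of X)).ιChainComplex (R := AddCommGrpCat.of (ULift.{u} ℤ))
      (loopSimplex γ) ≫ (integralSingularChains X).d 1 0 = 0 := by
  rw [SSet.ιChainComplex_d]
  simp [Fin.sum_univ_two, loopSimplex_δ]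

/-- The class in `H₁(X, ℤ)` of a loop `γ`, that is, of the singular `1`-cycle `1 • γ`. -/
def loopClass {X : Type u} [TopologicalSpace X] {x : X} (γ : Path x x) : integralH1 X :=
  ((integralSingularChains X).liftCycles
    ((TopCat.toSSet.obj (TopCat.of X)).ιChainComplex (loopSimplex γ)) 0 (by simp)
    (loopSimplex_d γ) ≫ (integralSingularChains X).homologyπ 1).hom (ULift.up 1)

/-- The length of a curve with respect to the distance of `M`. It is `∞` exactly if the curve
is not rectifiable. On a Riemannian manifold with its Riemannian distance, this is `∫_γ ds`. -/
def loopLength {M : Type u} [EMetricSpace M] {x : M} (γ : Path x x) : ℝ≥0∞ :=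
  eVariationOn γ Set.univ

/-- `l(a)`: the infimum of the lengths of all loops in the homology class `a`. -/
def minLoopLength {M : Type u} [EMetricSpace M] (a : integralH1 M) : ℝ≥0∞ :=
  ⨅ (x : M) (γ : Path x x) (_ : loopClass γ = a), loopLength γ

end

/-! Two loops can be joined by a path of bounded length run back and forth, so `l` is subadditive up
to a constant. Fekete's lemma (`exists_tendsto_minLoopLength_div`) gives the limit, and
subadditivity, homogeneity and `‖a‖ ≤ l(a)` pass to it.

The substance is the lower bound `exists_abs_le_minLoopLength`: every homomorphism `φ : H₁ → ℝ` is
bounded by an affine function of `l`, hence, on replacing `a` by `n • a` and dividing by `n`, by a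
multiple of the stable norm. No differential forms enter. Since `ℝ` is divisible, `φ` extends from
`H₁` to a homomorphism `Φ` on 1-chains modulo boundaries. Up to the coboundary of a function `τ`,
`Φ` is bounded on all short paths (`exists_coboundary_bound`). A loop is cut into about length/`ρ`
short pieces, and `τ` cancels along it. Non-torsion classes are detected by some `φ`, so their norm
is positive.

The norm on `ℝ ⊗ H₁` is the supremum of the extended `|φ|` over all `φ` dominated by the stable
norm. A Hahn-Banach theorem for commutative groups shows that it takes the prescribed values, and
the lower bound makes it definite. Uniqueness follows by approximation with tensors `d⁻¹ ⊗ a`. -/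

noncomputable section

/-! ### Paths as singular 1-chains modulo boundaries -/

/-- A path `p : [0, 1] → X`, seen as a singular `1`-simplex of `X`. -/
def arcSimplex {X : Type u} [TopologicalSpace X] (p : C(unitInterval, X)) :
    (TopCat.toSSet.obj (TopCat.of X)) _⦋1⦌ :=
  ((TopCat.of X).toSSetObjEquiv (.op ⦋1⦌)).symm
    (p.comp ⟨stdSimplexHomeomorphUnitInterval, stdSimplexHomeomorphUnitInterval.continuous⟩)

/-- The class of a path in the quotient of the singular `1`-chains by the boundaries. -/
def arcClass {X : Type u} [TopologicalSpace X] (p : C(unitInterval, X)) :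
    ((integralSingularChains X).opcycles 1 : AddCommGrpCat.{u}) :=
  ((TopCat.toSSet.obj (TopCat.of X)).ιChainComplex (arcSimplex p) ≫
    (integralSingularChains X).pOpcycles 1).hom (ULift.up 1)

/-- The inclusion of `H₁(X, ℤ)` into the singular `1`-chains modulo boundaries. -/
def homologyToChains (X : Type u) [TopologicalSpace X] :
    integralH1 X →+ ((integralSingularChains X).opcycles 1 : AddCommGrpCat.{u}) :=
  ((integralSingularChains X).homologyι 1).hom

lemma homologyToChains_injective (X : Type u) [TopologicalSpace X] :
    Function.Injective (homologyToChains X) :=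
  (AddCommGrpCat.mono_iff_injective _).1
    (inferInstance : Mono ((integralSingularChains X).homologyι 1))

/-- The segment from `u` to `v`, as a continuous map on the unit interval. -/
def segmentMap {V : Type*} [AddCommGroup V] [Module ℝ V] [TopologicalSpace V]
    [IsTopologicalAddGroup V] [ContinuousSMul ℝ V] (u v : V) : C(unitInterval, V) :=
  ⟨fun t => AffineMap.lineMap u v (t : ℝ), by
    simp only [AffineMap.lineMap_apply_module]; fun_prop⟩

/-- The three segments are the faces of a singular 2-simplex, the affine triangle followed by `F`,
and its boundary dies in the quotient. Degenerate triangles are allowed; the relations for constant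
paths, concatenations and homotopies all come from this one. -/
lemma arcClass_triangle {X : Type u} [TopologicalSpace X] {V : Type*} [AddCommGroup V] [Module ℝ V]
    [TopologicalSpace V] [IsTopologicalAddGroup V] [ContinuousSMul ℝ V] (F : C(V, X)) (u v w : V) :
    arcClass (F.comp (segmentMap u v)) + arcClass (F.comp (segmentMap v w)) =
      arcClass (F.comp (segmentMap u w)) := by
  let G : C(stdSimplex ℝ (Fin 3), X) := F.comp
    ⟨fun a => a.1 0 • u + a.1 1 • v + a.1 2 • w, by
      have h : ∀ i : Fin 3, Continuous fun a : stdSimplex ℝ (Fin 3) => a.1 i :=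
        fun i => (continuous_apply i).comp continuous_subtype_val
      exact (((h 0).smul continuous_const).add ((h 1).smul continuous_const)).add
        ((h 2).smul continuous_const)⟩
  let s : (TopCat.toSSet.obj (TopCat.of X)) _⦋2⦌ :=
    ((TopCat.of X).toSSetObjEquiv (.op ⦋2⦌)).symm G
  have hδ : ∀ (i : Fin 3) (p : C(unitInterval, X)),
      (∀ z : stdSimplex ℝ (Fin 2), G (stdSimplex.map i.succAbove z) =
        p (stdSimplexHomeomorphUnitInterval z)) →
      (TopCat.toSSet.obj (TopCat.of X)).δ i s = arcSimplex p := by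
    intro i p h
    apply ((TopCat.of X).toSSetObjEquiv (.op ⦋1⦌)).injective
    ext z
    exact h z
  have hz : ∀ z : stdSimplex ℝ (Fin 2), z.1 0 = 1 - z.1 1 := fun z => by
    have := z.2.2
    rw [Fin.sum_univ_two] at this
    linarith
  have hm : ∀ (i : Fin 3) (z : stdSimplex ℝ (Fin 2)) (j : Fin 3),
      (stdSimplex.map i.succAbove z).1 j = ∑ k with i.succAbove k = j, z.1 k := fun i z j =>
    FunOnFinite.linearMap_apply_apply _ _ _ _ _
  have hG : ∀ (i j k : Fin 3) (a b : V), i.succAbove 0 = j → i.succAbove 1 = k →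
      (∀ c : Fin 3 → ℝ, c i = 0 → c 0 • u + c 1 • v + c 2 • w = c j • a + c k • b) →
      (TopCat.toSSet.obj (TopCat.of X)).δ i s = arcSimplex (F.comp (segmentMap a b)) := by
    intro i j k a b hj hk h
    refine hδ i _ fun z => congrArg F ?_
    have hj' : (stdSimplex.map i.succAbove z).1 j = z.1 0 := by
      rw [hm, ← hj]; simp [Finset.sum_filter]
    have hk' : (stdSimplex.map i.succAbove z).1 k = z.1 1 := by
      rw [hm, ← hk]; simp [Finset.sum_filter]
    refine (h (stdSimplex.map i.succAbove z).1 ?_).trans ?_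
    · rw [hm]; simp [Fin.succAbove_ne]
    · rw [hj', hk', hz]
      exact (AffineMap.lineMap_apply_module a b (z.1 1)).symm
  have h0 := hG 0 1 2 v w rfl rfl fun c hc => by simp [hc]
  have h1 := hG 1 0 2 u w rfl rfl fun c hc => by simp [hc]
  have h2 := hG 2 0 1 u v rfl rfl fun c hc => by simp [hc]
  have key : (TopCat.toSSet.obj (TopCat.of X)).ιChainComplex
      (R := AddCommGrpCat.of (ULift.{u} ℤ)) s ≫
      (integralSingularChains X).d 2 1 ≫ (integralSingularChains X).pOpcycles 1 = 0 := by
    simp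
  rw [SSet.ιChainComplex_d_assoc] at key
  simp only [Nat.reduceAdd, Fin.sum_univ_three, h0, h1, h2, Fin.val_zero, Fin.val_one, Fin.val_two, pow_zero,
    pow_one, one_smul, neg_smul, even_two, Even.neg_pow, one_pow, Preadditive.add_comp,
    Preadditive.neg_comp] at key
  have h := congrArg (fun f => f.hom (ULift.up (1 : ℤ))) key
  change arcClass (F.comp (segmentMap v w)) + -arcClass (F.comp (segmentMap u w)) +
    arcClass (F.comp (segmentMap u v)) = 0 at h
  rw [← sub_eq_zero, ← h]
  abel

/-- The class of a path in the quotient of the singular `1`-chains by the boundaries. -/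
def pathClass {X : Type u} [TopologicalSpace X] {x y : X} (p : Path x y) :
    ((integralSingularChains X).opcycles 1 : AddCommGrpCat.{u}) :=
  arcClass p.toContinuousMap

section PathClass

variable {X : Type u} [TopologicalSpace X] {x y z : X}

lemma pathClass_refl (x : X) : pathClass (Path.refl x) = 0 := by
  have h := arcClass_triangle (ContinuousMap.const ℝ x) 0 0 0
  rwa [add_eq_left] at h

lemma pathClass_trans (p : Path x y) (q : Path y z) :
    pathClass (p.trans q) = pathClass p + pathClass q := by
  have h := arcClass_triangle ⟨(p.trans q).extend, (p.trans q).continuous_extend⟩ 0 (1 / 2) 1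
  rw [pathClass, pathClass, pathClass]
  convert h.symm using 2
  · ext t
    have h2 : AffineMap.lineMap (0 : ℝ) 1 (t : ℝ) = (t : ℝ) := by
      simp [AffineMap.lineMap_apply_module]
    simp [segmentMap, h2]
  · congr 1
    ext t
    have ht := t.2
    have h2 : AffineMap.lineMap (0 : ℝ) (1 / 2) (t : ℝ) = (t : ℝ) / 2 := by
      simp [AffineMap.lineMap_apply_module]; ring
    simp only [segmentMap, ContinuousMap.comp_apply, ContinuousMap.coe_mk, h2]
    rw [Path.extend_apply _ (by constructor <;> linarith [ht.1, ht.2]), Path.trans_apply]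
    simp only
    rw [dif_pos (by linarith [ht.2])]
    change p t = _
    congr 1
    ext
    simp
    ring
  · congr 1
    ext t
    have ht := t.2
    have h2 : AffineMap.lineMap (1 / 2 : ℝ) 1 (t : ℝ) = (1 + (t : ℝ)) / 2 := by
      simp [AffineMap.lineMap_apply_module]; ring
    simp only [segmentMap, ContinuousMap.comp_apply, ContinuousMap.coe_mk, h2]
    rw [Path.extend_apply _ (by constructor <;> linarith [ht.1, ht.2])]
    rcases ht.1.eq_or_lt with h0 | h0
    · have : t = 0 := Subtype.ext h0.symm
      subst this
      change q 0 = _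
      simp [Path.trans_apply]
    rw [Path.trans_apply]
    simp only
    rw [dif_neg (by linarith)]
    change q t = _
    congr 1
    ext
    simp
    ring

/-- The diagonal cuts the square of the homotopy into two triangles; two sides of the square are
constant paths and contribute nothing. -/
lemma pathClass_eq_of_homotopic {p q : Path x y} (h : p.Homotopic q) :
    pathClass p = pathClass q := by
  obtain ⟨H⟩ := h
  let F : C(ℝ × ℝ, X) := H.toContinuousMap.comp
    ⟨fun a => (Set.projIcc 0 1 zero_le_one a.1, Set.projIcc 0 1 zero_le_one a.2),
      (continuous_projIcc.comp continuous_fst).prodMk (continuous_projIcc.comp continuous_snd)⟩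
  have h1 := arcClass_triangle F (0, 0) (0, 1) (1, 1)
  have h2 := arcClass_triangle F (0, 0) (1, 0) (1, 1)
  have e1 : F.comp (segmentMap (0, 0) (0, 1)) = p.toContinuousMap := by
    ext t; simp [F, segmentMap, AffineMap.lineMap_apply_module]
  have e2 : F.comp (segmentMap (0, 1) (1, 1)) = (Path.refl y).toContinuousMap := by
    ext t; simp [F, segmentMap, AffineMap.lineMap_apply_module]
  have e3 : F.comp (segmentMap (0, 0) (1, 0)) = (Path.refl x).toContinuousMap := by
    ext t; simp [F, segmentMap, AffineMap.lineMap_apply_module]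
  have e4 : F.comp (segmentMap (1, 0) (1, 1)) = q.toContinuousMap := by
    ext t; simp [F, segmentMap, AffineMap.lineMap_apply_module]
  rw [e1, e2] at h1
  rw [e3, e4, ← h1] at h2
  change pathClass _ + pathClass _ = pathClass _ + pathClass _ at h2
  rwa [pathClass_refl, pathClass_refl, zero_add, add_zero, eq_comm] at h2

lemma pathClass_symm (p : Path x y) : pathClass p.symm = - pathClass p := by
  rw [eq_neg_iff_add_eq_zero, add_comm, ← pathClass_trans, ← pathClass_refl x]
  exact pathClass_eq_of_homotopic ⟨(Path.Homotopy.reflTransSymm p).symm⟩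

lemma pathClass_subpath_add (p : Path x y) (a b c : unitInterval) :
    pathClass (p.subpath a b) + pathClass (p.subpath b c) = pathClass (p.subpath a c) := by
  rw [← pathClass_trans]
  exact pathClass_eq_of_homotopic ⟨Path.Homotopy.subpathTransSubpath p a b c⟩

lemma pathClass_subpath_zero_one (p : Path x y) : pathClass (p.subpath 0 1) = pathClass p := by
  rw [Path.subpath_zero_one]
  rfl

lemma homologyToChains_loopClass (γ : Path x x) :
    homologyToChains X (loopClass γ) = pathClass γ := by
  have h : ((integralSingularChains X).liftCycles
    ((TopCat.toSSet.obj (TopCat.of X)).ιChainComplex (loopSimplex γ)) 0 (by simp)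
    (loopSimplex_d γ) ≫ (integralSingularChains X).homologyπ 1) ≫
      (integralSingularChains X).homologyι 1 =
      (TopCat.toSSet.obj (TopCat.of X)).ιChainComplex (loopSimplex γ) ≫
        (integralSingularChains X).pOpcycles 1 := by
    simp
  exact congrArg (fun f => f.hom (ULift.up (1 : ℤ))) h

lemma loopClass_trans (γ δ : Path x x) :
    loopClass (γ.trans δ) = loopClass γ + loopClass δ := by
  apply homologyToChains_injective
  simp only [map_add, homologyToChains_loopClass, pathClass_trans]

lemma loopClass_refl (x : X) : loopClass (Path.refl x) = 0 := by
  apply homologyToChains_injective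
  rw [homologyToChains_loopClass, pathClass_refl, map_zero]

lemma loopClass_symm (γ : Path x x) : loopClass γ.symm = - loopClass γ := by
  apply homologyToChains_injective
  simp only [map_neg, homologyToChains_loopClass, pathClass_symm]

/-- The classes of the loops at `x`. -/
def loopSubgroup (x : X) :
    AddSubgroup ((integralSingularChains X).opcycles 1 : AddCommGrpCat.{u}) where
  carrier := {c | ∃ γ : Path x x, pathClass γ = c}
  zero_mem' := ⟨Path.refl x, pathClass_refl x⟩
  add_mem' := by
    rintro _ _ ⟨γ, rfl⟩ ⟨δ, rfl⟩
    exact ⟨γ.trans δ, pathClass_trans γ δ⟩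
  neg_mem' := by
    rintro _ ⟨γ, rfl⟩
    exact ⟨γ.symm, pathClass_symm γ⟩

/-- Every homology class of degree one of a path connected space is the class of a loop. -/
lemma exists_loopClass_eq [PathConnectedSpace X] (x : X) (a : integralH1 X) :
    ∃ γ : Path x x, loopClass γ = a := by
  let Q := (integralSingularChains X).opcycles 1
  let S := TopCat.toSSet.obj (TopCat.of X)
  let hom : Q → (AddCommGrpCat.of (ULift.{u} ℤ) ⟶ Q) := fun c =>
    AddCommGrpCat.ofHom ((zmultiplesHom Q c).comp AddEquiv.ulift.toAddMonoidHom)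
  have hom_one : ∀ c, (hom c).hom (ULift.up 1) = c := fun c => one_zsmul c
  have hom_ext : ∀ {A : AddCommGrpCat.{u}} {f g : AddCommGrpCat.of (ULift.{u} ℤ) ⟶ A},
      f.hom (ULift.up 1) = g.hom (ULift.up 1) → f = g := by
    intro A f g h
    ext ⟨n⟩
    have : (ULift.up n : ULift.{u} ℤ) = n • ULift.up 1 := by ext; simp
    rw [this]
    exact ((map_zsmul f.hom n (ULift.up 1)).trans (congrArg _ h)).trans
      (map_zsmul g.hom n (ULift.up 1)).symm
  let β : ∀ y : X, Path x y := fun y => PathConnectedSpace.somePath x y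
  let pt : S _⦋0⦌ → X := fun s => (TopCat.of X).toSSetObjEquiv (.op ⦋0⦌) s (stdSimplex.vertex 0)
  -- Sends a point `y` to the class of the chosen path `β y` from `x`. For a 1-chain `c`, the class
  -- of `c - T(∂c)` is then a combination of classes of loops at `x`; on cycles the correction
  -- vanishes.
  let T : (integralSingularChains X).X 0 ⟶ Q :=
    (S.isColimitChainComplexXCofan (AddCommGrpCat.of (ULift.{u} ℤ)) 0).desc
      (Limits.Cofan.mk _ fun s => hom (pathClass (β (pt s))))
  have hT : ∀ s : S _⦋0⦌, S.ιChainComplex s ≫ T = hom (pathClass (β (pt s))) := fun s =>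
    (S.isColimitChainComplexXCofan (AddCommGrpCat.of (ULift.{u} ℤ)) 0).fac _ ⟨s⟩
  let quot : Q ⟶ AddCommGrpCat.of (Q ⧸ loopSubgroup x) :=
    AddCommGrpCat.ofHom (QuotientAddGroup.mk' (loopSubgroup x))
  have key : ((integralSingularChains X).pOpcycles 1 - (integralSingularChains X).d 1 0 ≫ T) ≫ quot
      = 0 := by
    refine SSet.chainComplex_hom_ext fun s => hom_ext ?_
    obtain ⟨p, rfl⟩ : ∃ p, arcSimplex p = s := by
      refine ⟨((TopCat.of X).toSSetObjEquiv (.op ⦋1⦌) s).comp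
        ⟨stdSimplexHomeomorphUnitInterval.symm, stdSimplexHomeomorphUnitInterval.symm.continuous⟩, ?_⟩
      apply ((TopCat.of X).toSSetObjEquiv (.op ⦋1⦌)).injective
      ext z
      exact congrArg ((TopCat.of X).toSSetObjEquiv (.op ⦋1⦌) s)
        (stdSimplexHomeomorphUnitInterval.symm_apply_apply z)
    have hpt : ∀ i : Fin 2, pt (S.δ i (arcSimplex p)) =
        p (stdSimplexHomeomorphUnitInterval (stdSimplex.vertex (i.succAbove 0))) := by
      intro i
      rw [← stdSimplex.map_vertex]
      rfl
    have hpt0 : pt (S.δ 0 (arcSimplex p)) = p 1 := hpt 0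
    have hpt1 : pt (S.δ 1 (arcSimplex p)) = p 0 := hpt 1
    have e : S.ιChainComplex (arcSimplex p) ≫ (integralSingularChains X).d 1 0 ≫ T =
        hom (pathClass (β (p 1))) - hom (pathClass (β (p 0))) := by
      rw [SSet.ιChainComplex_d_assoc]
      simp only [Nat.reduceAdd, Fin.sum_univ_two, Fin.val_zero, Fin.val_one, pow_zero, pow_one,
        one_smul, neg_smul, Preadditive.add_comp, Preadditive.neg_comp]
      rw [hT, hT, hpt0, hpt1, sub_eq_add_neg]
    rw [Limits.comp_zero, ← Category.assoc, Preadditive.comp_sub, e]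
    change quot.hom (arcClass p - ((hom (pathClass (β (p 1)))).hom (ULift.up 1) -
      (hom (pathClass (β (p 0)))).hom (ULift.up 1))) = 0
    rw [hom_one, hom_one]
    refine (QuotientAddGroup.eq_zero_iff _).2
      ⟨((β (p 0)).trans ⟨p, rfl, rfl⟩).trans (β (p 1)).symm, ?_⟩
    rw [pathClass_trans, pathClass_trans, pathClass_symm]
    change pathClass _ + arcClass p + _ = _
    abel
  obtain ⟨z, rfl⟩ := (AddCommGrpCat.epi_iff_surjective _).1
    (inferInstance : Epi ((integralSingularChains X).homologyπ 1)) a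
  have hz : (integralSingularChains X).iCycles 1 ≫ (integralSingularChains X).pOpcycles 1 ≫ quot
      = 0 := by
    have := congrArg (fun f => (integralSingularChains X).iCycles 1 ≫ f) key
    simpa [Preadditive.sub_comp, Preadditive.comp_sub] using this
  have hz' : quot.hom (((integralSingularChains X).pOpcycles 1).hom
      (((integralSingularChains X).iCycles 1).hom z)) = 0 :=
    congrArg (fun f => f.hom z) hz
  obtain ⟨γ, hγ⟩ := (QuotientAddGroup.eq_zero_iff _).1 hz'
  refine ⟨γ, homologyToChains_injective X ?_⟩
  rw [homologyToChains_loopClass, hγ]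
  exact congrArg (fun f => f.hom z) ((integralSingularChains X).homology_π_ι 1).symm

end PathClass
end

/-! ### Hahn-Banach for commutative groups -/

/-- A function on a commutative group is `ℕ`-sublinear if it is subadditive and homogeneous. -/
structure IsNatSublinear {H : Type*} [AddCommGroup H] (p : H → ℝ) : Prop where
  add_le : ∀ x y, p (x + y) ≤ p x + p y
  nsmul : ∀ (n : ℕ) (x : H), p (n • x) = n * p x

namespace IsNatSublinear

variable {H : Type*} [AddCommGroup H] {p : H → ℝ}

lemma zero (hp : IsNatSublinear p) : p 0 = 0 := by simpa using hp.nsmul 0 0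

lemma neg_le (hp : IsNatSublinear p) (x : H) : -p (-x) ≤ p x := by
  have := hp.add_le x (-x)
  rw [add_neg_cancel, hp.zero] at this
  linarith

/-- Take the infimum of `p (x + n • v) - n * p v`, which is nonincreasing in `n`. Homogeneity comes
from comparing it with the subsequence of multiples; the terms `n = 0` and `n = 1` give the two
bounds. A minimal `p` must equal this shift, which forces additivity. -/
lemma exists_le_shift (hp : IsNatSublinear p) (v : H) :
    ∃ q : H → ℝ, IsNatSublinear q ∧ q ≤ p ∧ ∀ x, q x ≤ p (x + v) - p v := by
  let f : H → ℕ → ℝ := fun x n => p (x + n • v) - n * p v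
  have hb : ∀ x, BddBelow (Set.range (f x)) := by
    intro x
    refine ⟨-p (-x), ?_⟩
    rintro _ ⟨n, rfl⟩
    have := hp.add_le (x + n • v) (-x)
    rw [show x + n • v + -x = n • v by abel, hp.nsmul] at this
    simp only [f]
    linarith
  have hanti : ∀ x (n k : ℕ), f x (n + k) ≤ f x n := by
    intro x n k
    have := hp.add_le (x + n • v) (k • v)
    rw [hp.nsmul, add_assoc, ← add_nsmul] at this
    simp only [f]
    push_cast
    linarith
  have hq : ∀ x n, ⨅ i, f x i ≤ f x n := fun x n => ciInf_le (hb x) n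
  refine ⟨fun x => ⨅ n, f x n, ⟨fun x y => ?_, fun n x => ?_⟩, fun x => ?_, fun x => ?_⟩
  · refine le_ciInf_add_ciInf fun i j => (hq _ (i + j)).trans ?_
    have := hp.add_le (x + i • v) (y + j • v)
    rw [show x + i • v + (y + j • v) = x + y + (i + j) • v by rw [add_nsmul]; abel] at this
    simp only [f]
    push_cast
    linarith
  · have hmul : ∀ i, f (n • x) (n * i) = n * f x i := by
      intro i
      simp only [f]
      rw [mul_smul, ← smul_add, hp.nsmul]
      push_cast
      ring
    rcases Nat.eq_zero_or_pos n with rfl | hn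
    · have : ∀ i, f ((0 : ℕ) • x) i = 0 := fun i => by simp [f, hp.nsmul]
      simp only [this, ciInf_const, Nat.cast_zero, zero_mul]
    · apply le_antisymm
      · rw [Real.mul_iInf_of_nonneg n.cast_nonneg]
        exact le_ciInf fun i => (hq _ (n * i)).trans_eq (hmul i)
      · refine le_ciInf fun i => ?_
        have h1 : f (n • x) (n * i) ≤ f (n • x) i := by
          obtain ⟨k, hk⟩ := Nat.exists_eq_add_of_le (Nat.le_mul_of_pos_left i hn)
          rw [hk]
          exact hanti _ _ _
        rw [hmul] at h1
        exact (mul_le_mul_of_nonneg_left (hq x i) n.cast_nonneg).trans h1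
  · simpa [f] using hq x 0
  · simpa [f] using hq x 1

lemma exists_minimal_le (hp : IsNatSublinear p) :
    ∃ m : H → ℝ, m ≤ p ∧ Minimal IsNatSublinear m := by
  have h := zorn_le_nonempty₀ (α := (H → ℝ)ᵒᵈ) {q | IsNatSublinear (OrderDual.ofDual q)} ?_
    (OrderDual.toDual p) hp
  · obtain ⟨m, hm, hmax⟩ := h
    exact ⟨OrderDual.ofDual m, hm, hmax.1, fun q hq hle => hmax.2 (y := OrderDual.toDual q) hq hle⟩
  intro c hc hchain y hy
  let g : c → H → ℝ := fun q => OrderDual.ofDual q.1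
  have hg : ∀ q, IsNatSublinear (g q) := fun q => hc q.2
  have hdir : ∀ i j : c, ∃ k, g k ≤ g i ∧ g k ≤ g j := by
    intro i j
    rcases hchain.total i.2 j.2 with h | h
    · exact ⟨j, h, le_rfl⟩
    · exact ⟨i, le_rfl, h⟩
  have hb : ∀ x, BddBelow (Set.range fun i => g i x) := by
    intro x
    refine ⟨-g ⟨y, hy⟩ (-x), ?_⟩
    rintro _ ⟨i, rfl⟩
    obtain ⟨k, hk1, hk2⟩ := hdir i ⟨y, hy⟩
    have := (hg k).neg_le x
    have h1 := hk1 x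
    have h2 := hk2 (-x)
    simp only
    linarith
  have : Nonempty c := ⟨⟨y, hy⟩⟩
  refine ⟨OrderDual.toDual fun x => ⨅ i, g i x, ⟨fun u v => ?_, fun n x => ?_⟩, ?_⟩
  · refine le_ciInf_add_ciInf fun i j => ?_
    obtain ⟨k, hk1, hk2⟩ := hdir i j
    exact (ciInf_le (hb _) k).trans (((hg k).add_le u v).trans (add_le_add (hk1 u) (hk2 v)))
  · change ⨅ i, g i (n • x) = n * ⨅ i, g i x
    rw [Real.mul_iInf_of_nonneg n.cast_nonneg]
    exact iInf_congr fun i => (hg i).nsmul n x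
  · intro z hz x
    exact ciInf_le (hb x) ⟨z, hz⟩

/-- The Hahn-Banach theorem for commutative groups. -/
theorem exists_addMonoidHom_le (hp : IsNatSublinear p) (a : H) :
    ∃ φ : H →+ ℝ, (∀ x, φ x ≤ p x) ∧ φ a = p a := by
  -- Shifting by `a` before minimizing gives `q (-a) ≤ -p a`, which forces equality at `a` for any
  -- additive function below `q`.
  obtain ⟨q, hq, hqp, hqa⟩ := hp.exists_le_shift a
  obtain ⟨m, hmq, hm⟩ := hq.exists_minimal_le
  have hadd : ∀ x v, m (x + v) = m x + m v := by
    intro x v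
    obtain ⟨r, hr, hrm, hrv⟩ := hm.1.exists_le_shift v
    have h1 := hm.2 hr hrm x
    have h2 := hrv x
    have h3 := hm.1.add_le x v
    linarith
  let φ : H →+ ℝ := AddMonoidHom.mk' m hadd
  refine ⟨φ, fun x => (hmq x).trans (hqp x), le_antisymm ((hmq a).trans (hqp a)) ?_⟩
  have h1 : φ (-a) ≤ q (-a) := hmq (-a)
  have h2 := hqa (-a)
  rw [neg_add_cancel, hp.zero] at h2
  rw [map_neg] at h1
  linarith

end IsNatSublinear

/-! ### Norms on the real extension of a group -/

/-- An element of infinite order is detected by a homomorphism to the real numbers. -/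
lemma exists_addMonoidHom_real_ne_zero {H : Type*} [AddCommGroup H] {a : H}
    (ha : ¬ IsOfFinAddOrder a) : ∃ φ : H →+ ℝ, φ a ≠ 0 := by
  obtain ⟨φ, hφ⟩ := (Module.Baer.of_divisible ℝ).extension_property_addMonoidHom
    (zmultiplesHom H a) (injective_zsmul_iff_not_isOfFinAddOrder.2 ha) (Int.castAddHom ℝ)
  have := DFunLike.congr_fun hφ 1
  refine ⟨φ, fun h => ?_⟩
  simp [h] at this

/-- The real linear extension of a homomorphism `H → ℝ` to `ℝ ⊗ H`. -/
noncomputable def realExtension {H : Type*} [AddCommGroup H] (φ : H →+ ℝ) :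
    ℝ ⊗[ℤ] H →ₗ[ℝ] ℝ :=
  (TensorProduct.isBaseChange ℤ H ℝ).lift φ.toIntLinearMap

lemma realExtension_tmul {H : Type*} [AddCommGroup H] (φ : H →+ ℝ) (t : ℝ) (a : H) :
    realExtension φ (t ⊗ₜ[ℤ] a) = t * φ a := by
  have h : t ⊗ₜ[ℤ] a = t • ((1 : ℝ) ⊗ₜ[ℤ] a) := by simp [TensorProduct.smul_tmul']
  have h1 : realExtension φ ((1 : ℝ) ⊗ₜ[ℤ] a) = φ a :=
    (TensorProduct.isBaseChange ℤ H ℝ).lift_eq φ.toIntLinearMap a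
  rw [h, map_smul, h1, smul_eq_mul]

section NormExtension

variable {H : Type*} [AddCommGroup H] {ν : H → ℝ}

/-- The supremum of the seminorms `|realExtension φ|` over `|φ| ≤ ν`. Hahn-Banach makes it attain
`|t| * ν a` on pure tensors. It is definite because, by `hdom`, every linear form on the tensor
product is a multiple of one occurring in the supremum. -/
lemma exists_norm_extension (hν : IsNatSublinear ν) (hneg : ∀ a, ν (-a) = ν a)
    (hdom : ∀ φ : H →+ ℝ, ∃ C : ℝ, ∀ a, |φ a| ≤ C * ν a) :
    ∃ N : Seminorm ℝ (ℝ ⊗[ℤ] H), (∀ x, N x = 0 → x = 0) ∧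
      ∀ (t : ℝ) (a : H), N (t ⊗ₜ[ℤ] a) = |t| * ν a := by
  have hnn : ∀ a, 0 ≤ ν a := fun a => by
    have := hν.neg_le a
    rw [hneg] at this
    linarith
  let D := {φ : H →+ ℝ // ∀ a, |φ a| ≤ ν a}
  have : Nonempty D := ⟨⟨0, fun a => by simpa using hnn a⟩⟩
  let P : D → Seminorm ℝ (ℝ ⊗[ℤ] H) := fun φ => (normSeminorm ℝ ℝ).comp (realExtension φ.1)
  have hP : ∀ φ x, P φ x = |realExtension φ.1 x| := fun φ x => rfl
  have hPt : ∀ φ t a, P φ (t ⊗ₜ[ℤ] a) ≤ |t| * ν a := by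
    intro φ t a
    rw [hP, realExtension_tmul, abs_mul]
    exact mul_le_mul_of_nonneg_left (φ.2 a) (abs_nonneg t)
  have hb : BddAbove (Set.range P) := by
    rw [Seminorm.bddAbove_range_iff]
    intro x
    suffices ∃ B, ∀ φ, P φ x ≤ B by
      obtain ⟨B, hB⟩ := this
      exact ⟨B, by rintro _ ⟨φ, rfl⟩; exact hB φ⟩
    induction x with
    | zero => exact ⟨0, fun φ => (map_zero _).le⟩
    | tmul t a => exact ⟨_, fun φ => hPt φ t a⟩
    | add x y hx hy =>
      obtain ⟨B, hB⟩ := hx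
      obtain ⟨B', hB'⟩ := hy
      exact ⟨B + B', fun φ => (map_add_le_add _ _ _).trans (add_le_add (hB φ) (hB' φ))⟩
  have hle : ∀ φ x, P φ x ≤ (⨆ φ, P φ) x := fun φ x => le_ciSup hb φ x
  refine ⟨⨆ φ, P φ, fun x hx => ?_, fun t a => le_antisymm ?_ ?_⟩
  · rw [← Module.forall_dual_apply_eq_zero_iff ℝ]
    intro l
    let φ : H →+ ℝ := l.toAddMonoidHom.comp (TensorProduct.mk ℤ ℝ H 1).toAddMonoidHom
    obtain ⟨C, hC⟩ := hdom φ
    have hC' : 0 < |C| + 1 := by positivity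
    let ψ : D := ⟨(AddMonoidHom.mulLeft (|C| + 1)⁻¹).comp φ, fun a => by
      rw [AddMonoidHom.comp_apply, AddMonoidHom.coe_mulLeft, abs_mul, abs_of_pos (inv_pos.2 hC'),
        inv_mul_le_iff₀ hC']
      exact (hC a).trans (mul_le_mul_of_nonneg_right
        ((le_abs_self C).trans (by linarith)) (hnn a))⟩
    have h0 : realExtension ψ.1 x = 0 := by
      have := hle ψ x
      rw [hx, hP] at this
      exact abs_nonpos_iff.1 this
    have hl : l = (|C| + 1) • realExtension ψ.1 := by
      apply TensorProduct.AlgebraTensorModule.ext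
      intro t a
      have h : t ⊗ₜ[ℤ] a = t • ((1 : ℝ) ⊗ₜ[ℤ] a) := by simp [TensorProduct.smul_tmul']
      rw [LinearMap.smul_apply, realExtension_tmul, h, map_smul]
      change t * φ a = (|C| + 1) * (t * ((|C| + 1)⁻¹ * φ a))
      field_simp
    rw [hl, LinearMap.smul_apply, h0, smul_zero]
  · rw [Seminorm.iSup_apply hb]
    exact ciSup_le fun φ => hPt φ t a
  · obtain ⟨φ, hφ, hφa⟩ := hν.exists_addMonoidHom_le a
    have hφ' : ∀ x, |φ x| ≤ ν x := fun x => abs_le.2 ⟨by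
      have := hφ (-x)
      rw [hneg, map_neg] at this
      linarith, hφ x⟩
    refine le_trans (le_of_eq ?_) (hle ⟨φ, hφ'⟩ _)
    rw [hP, realExtension_tmul, hφa, abs_mul, abs_of_nonneg (hnn a)]

/-- Rational approximation and common denominators make the tensors `d⁻¹ ⊗ a` dense for both
seminorms simultaneously, and the two agree there. -/
lemma norm_extension_unique {N N' : Seminorm ℝ (ℝ ⊗[ℤ] H)}
    (h : ∀ (t : ℝ) (a : H), N (t ⊗ₜ[ℤ] a) = |t| * ν a)
    (h' : ∀ (t : ℝ) (a : H), N' (t ⊗ₜ[ℤ] a) = |t| * ν a) : N = N' := by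
  have key : ∀ x : ℝ ⊗[ℤ] H, ∀ ε > 0, ∃ (d : ℕ) (a : H), d ≠ 0 ∧
      N (x - (d : ℝ)⁻¹ ⊗ₜ[ℤ] a) < ε ∧ N' (x - (d : ℝ)⁻¹ ⊗ₜ[ℤ] a) < ε := by
    intro x
    induction x with
    | zero => exact fun ε hε => ⟨1, 0, one_ne_zero, by simpa, by simpa⟩
    | tmul t a =>
      intro ε hε
      have hB : 0 < |ν a| + 1 := by positivity
      obtain ⟨q, hq⟩ := exists_rat_near t (div_pos hε hB)
      have hqa : (q.den : ℝ)⁻¹ ⊗ₜ[ℤ] (q.num • a) = (q : ℝ) ⊗ₜ[ℤ] a := by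
        rw [← TensorProduct.smul_tmul, zsmul_eq_mul, ← div_eq_mul_inv, ← Rat.cast_def]
      have hlt : |t - q| * ν a < ε := by
        calc |t - q| * ν a ≤ |t - q| * (|ν a| + 1) :=
              mul_le_mul_of_nonneg_left ((le_abs_self _).trans (by linarith)) (abs_nonneg _)
          _ < ε := (lt_div_iff₀ hB).1 hq
      refine ⟨q.den, q.num • a, q.den_ne_zero, ?_, ?_⟩
      · rwa [hqa, ← TensorProduct.sub_tmul, h]
      · rwa [hqa, ← TensorProduct.sub_tmul, h']
    | add x y hx hy =>
      intro ε hε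
      obtain ⟨d, a, hd, h1, h2⟩ := hx _ (half_pos hε)
      obtain ⟨e, b, he, h3, h4⟩ := hy _ (half_pos hε)
      have hs : ((d * e : ℕ) : ℝ)⁻¹ ⊗ₜ[ℤ] (e • a + d • b) =
          (d : ℝ)⁻¹ ⊗ₜ[ℤ] a + (e : ℝ)⁻¹ ⊗ₜ[ℤ] b := by
        have hd' : (d : ℝ) ≠ 0 := by exact_mod_cast hd
        have he' : (e : ℝ) ≠ 0 := by exact_mod_cast he
        rw [TensorProduct.tmul_add, ← TensorProduct.smul_tmul, ← TensorProduct.smul_tmul,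
          nsmul_eq_mul, nsmul_eq_mul]
        congr 2 <;> push_cast <;> field_simp
      have hsub : x + y - ((d * e : ℕ) : ℝ)⁻¹ ⊗ₜ[ℤ] (e • a + d • b) =
          (x - (d : ℝ)⁻¹ ⊗ₜ[ℤ] a) + (y - (e : ℝ)⁻¹ ⊗ₜ[ℤ] b) := by rw [hs]; abel
      refine ⟨d * e, e • a + d • b, mul_ne_zero hd he, ?_, ?_⟩
      · rw [hsub]
        exact (map_add_le_add N _ _).trans_lt (by linarith)
      · rw [hsub]
        exact (map_add_le_add N' _ _).trans_lt (by linarith)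
  ext x
  refine eq_of_abs_sub_le_all fun ε hε => ?_
  obtain ⟨d, a, -, h1, h2⟩ := key x (ε / 2) (half_pos hε)
  have e1 := abs_sub_map_le_sub N x ((d : ℝ)⁻¹ ⊗ₜ[ℤ] a)
  have e2 := abs_sub_map_le_sub N' x ((d : ℝ)⁻¹ ⊗ₜ[ℤ] a)
  rw [h] at e1
  rw [h'] at e2
  rw [abs_le] at *
  constructor <;> linarith [e1.1, e1.2, e2.1, e2.2]

end NormExtension

/-! ### Local geometry of the manifold -/

section Chart

variable {E : Type*} [NormedAddCommGroup E] [NormedSpace ℝ E]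

/-- In the chart both paths lie in a convex, hence simply connected, set; a homotopy there is
carried back to `M`. -/
lemma pathClass_eq_of_mem_chart {M : Type u} [TopologicalSpace M] (e : OpenPartialHomeomorph M E)
    {s : Set E} (hs : Convex ℝ s) (hst : s ⊆ e.target) {y z : M} (p q : Path y z)
    (hp : ∀ t, p t ∈ e.source ∩ e ⁻¹' s) (hq : ∀ t, q t ∈ e.source ∩ e ⁻¹' s) :
    pathClass p = pathClass q := by
  have hy : e y ∈ s := by simpa using (hp 0).2
  have hz : e z ∈ s := by simpa using (hp 1).2
  have : ContractibleSpace s := hs.contractibleSpace ⟨_, hy⟩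
  let f : C(s, M) := ⟨fun v => e.symm v, (e.continuousOn_symm.mono hst).domRestrict⟩
  let lift : ∀ p : Path y z, (∀ t, p t ∈ e.source ∩ e ⁻¹' s) → Path (⟨e y, hy⟩ : s) ⟨e z, hz⟩ :=
    fun p hp =>
      { toFun := fun t => ⟨e (p t), (hp t).2⟩
        continuous_toFun := Continuous.subtype_mk
          (e.continuousOn.comp_continuous p.continuous fun t => (hp t).1) _
        source' := by simp
        target' := by simp }
  have hlift : ∀ (p : Path y z) (hp), pathClass ((lift p hp).map f.continuous) = pathClass p := by
    intro p hp
    refine congrArg arcClass ?_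
    ext t
    exact e.left_inv (hp t).1
  rw [← hlift p hp, ← hlift q hq]
  exact pathClass_eq_of_homotopic ((SimplyConnectedSpace.paths_homotopic _ _).map f)

/-- In a compact manifold, the class of a path within a small ball is determined by its
end points. -/
lemma exists_radius_pathClass_eq (E : Type*) [NormedAddCommGroup E] [NormedSpace ℝ E]
    (M : Type u) [EMetricSpace M] [ChartedSpace E M] [CompactSpace M] :
    ∃ r > (0 : ℝ≥0∞), ∀ (x : M) {y z : M} (p q : Path y z), (∀ t, p t ∈ Metric.eball x r) →
      (∀ t, q t ∈ Metric.eball x r) → pathClass p = pathClass q := by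
  have h : ∀ x : M, ∃ s : Set E, Convex ℝ s ∧ s ⊆ (chartAt E x).target ∧
      (chartAt E x).source ∩ chartAt E x ⁻¹' s ∈ 𝓝 x := by
    intro x
    obtain ⟨ε, hε, hs⟩ := Metric.isOpen_iff.1 (chartAt E x).open_target _ (mem_chart_target E x)
    refine ⟨_, convex_ball (chartAt E x x) ε, hs, ?_⟩
    exact Filter.inter_mem (chart_source_mem_nhds E x)
      ((chartAt E x).continuousAt (mem_chart_source E x) (Metric.ball_mem_nhds _ hε))
  choose s hs hst hx using h
  obtain ⟨δ, hδ, H⟩ := lebesgue_number_lemma_of_emetric_nhds (isCompact_univ (X := M))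
    (fun x _ => hx x)
  refine ⟨δ, hδ, fun x y z p q hp hq => ?_⟩
  obtain ⟨w, hw⟩ := H x (Set.mem_univ x)
  exact pathClass_eq_of_mem_chart (chartAt E w) (hs w) (hst w) p q (fun t => hw (hp t))
    (fun t => hw (hq t))

end Chart

/-- Two points of a Riemannian manifold are joined by paths whose lengths are arbitrarily close
to their distance. -/
lemma exists_path_eVariationOn_lt {E H : Type*} [NormedAddCommGroup E] [NormedSpace ℝ E]
    [TopologicalSpace H] {I : ModelWithCorners ℝ E H} {M : Type*} [EMetricSpace M]
    [ChartedSpace H M] [RiemannianBundle (fun x : M => TangentSpace I x)]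
    [IsRiemannianManifold I M] {x y : M} {r : ℝ≥0∞} (h : edist x y < r) :
    ∃ p : Path x y, eVariationOn p Set.univ < r := by
  rw [IsRiemannianManifold.out (I := I) x y] at h
  obtain ⟨γ, h0, h1, hγ, hlen⟩ := Manifold.exists_lt_of_riemannianEDist_lt h
  refine ⟨⟨⟨fun t => γ t, hγ.continuousOn.domRestrict⟩, by simpa using h0, by simpa using h1⟩, ?_⟩
  refine lt_of_le_of_lt (iSup_le ?_) hlen
  rintro ⟨n, u, hu, -⟩
  -- Each chord is at most the Riemannian length of the arc it spans, so the variation is at most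
  -- the length of `γ`.
  have hsum : ∀ n : ℕ, ∑ i ∈ Finset.range n, edist (γ (u (i + 1))) (γ (u i)) ≤
      Manifold.pathELength I γ (u 0) (u n) := by
    intro n
    induction n with
    | zero => simp
    | succ n ih =>
      rw [Finset.sum_range_succ, ← Manifold.pathELength_add (hu (Nat.zero_le n)) (hu n.le_succ)]
      refine add_le_add ih ?_
      rw [edist_comm, IsRiemannianManifold.out (I := I)]
      exact Manifold.riemannianEDist_le_pathELength
        (hγ.mono (Set.Icc_subset_Icc (u n).2.1 (u (n + 1)).2.2)) rfl rfl (hu n.le_succ)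
  exact (hsum n).trans (Manifold.pathELength_mono (u 0).2.1 (u n).2.2)

/-- Being at finite distance is an equivalence relation that holds locally. -/
lemma edist_lt_top_of_preconnectedSpace {M : Type*} [EMetricSpace M] [PreconnectedSpace M]
    (x y : M) : edist x y < ⊤ := by
  refine isPreconnected_univ.induction₂ (fun x y : M => edist x y < ⊤) (fun x _ => ?_)
    (fun x y z _ _ _ hxy hyz => ?_) (fun x y _ _ h => ?_) (Set.mem_univ x) (Set.mem_univ y)
  · rw [nhdsWithin_univ]
    filter_upwards [Metric.eball_mem_nhds x one_pos] with y hy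
    rw [edist_comm]
    exact lt_trans hy ENNReal.one_lt_top
  · exact (edist_triangle x y z).trans_lt (ENNReal.add_lt_top.2 ⟨hxy, hyz⟩)
  · rwa [edist_comm]

lemma exists_edist_le_of_compactSpace (M : Type*) [EMetricSpace M] [CompactSpace M]
    [ConnectedSpace M] : ∃ D : ℝ≥0, ∀ x y : M, edist x y ≤ D := by
  obtain ⟨⟨a, b⟩, -, h⟩ := (isCompact_univ (X := M × M)).exists_isMaxOn Set.univ_nonempty
    (continuous_edist (α := M)).continuousOn
  refine ⟨(edist a b).toNNReal, fun x y => ?_⟩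
  rw [ENNReal.coe_toNNReal (edist_lt_top_of_preconnectedSpace a b).ne]
  exact h (Set.mem_univ (x, y))

/-! ### Lengths of loops and their minima -/

section Length

variable {M : Type u} [EMetricSpace M] {x y z : M}

lemma eVariationOn_path_trans_le (p : Path x y) (q : Path y z) :
    eVariationOn (p.trans q) Set.univ ≤ eVariationOn p Set.univ + eVariationOn q Set.univ := by
  let h : unitInterval := ⟨1 / 2, by norm_num, by norm_num⟩
  have hu : (Set.univ : Set unitInterval) = Set.Iic h ∪ Set.Ici h := Set.Iic_union_Ici.symm
  let φ : unitInterval → unitInterval := fun t => Set.projIcc 0 1 zero_le_one (2 * (t : ℝ))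
  let ψ : unitInterval → unitInterval := fun t => Set.projIcc 0 1 zero_le_one (2 * (t : ℝ) - 1)
  have hφ : Monotone φ := fun s t hst => Set.monotone_projIcc _
    (mul_le_mul_of_nonneg_left (Subtype.coe_le_coe.2 hst) zero_le_two)
  have hψ : Monotone ψ := fun s t hst => Set.monotone_projIcc _
    (sub_le_sub_right (mul_le_mul_of_nonneg_left (Subtype.coe_le_coe.2 hst) zero_le_two) _)
  have hp : Set.EqOn (p.trans q) (p ∘ φ) (Set.Iic h) := by
    intro t ht
    have ht' : (t : ℝ) ≤ 1 / 2 := ht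
    rw [Path.trans_apply, dif_pos ht']
    simp only [Function.comp_apply, φ]
    rw [Set.projIcc_of_mem]
  have hq : Set.EqOn (p.trans q) (q ∘ ψ) (Set.Ici h) := by
    intro t ht
    have ht' : 1 / 2 ≤ (t : ℝ) := ht
    rcases ht'.eq_or_lt with h0 | h0
    · rw [Path.trans_apply, dif_pos h0.ge]
      have h1 : ψ t = 0 := by simp [ψ, ← h0]
      have h2 : ∀ h, p ⟨2 * (t : ℝ), h⟩ = y := fun h => by
        
        refine Eq.trans (congrArg p (Subtype.ext ?_)) p.target
        simp [← h0]
      rw [h2, Function.comp_apply, h1, q.source]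
    · rw [Path.trans_apply, dif_neg h0.not_ge]
      simp only [Function.comp_apply, ψ]
      rw [Set.projIcc_of_mem]
  have hsum : eVariationOn (p.trans q) Set.univ =
      eVariationOn (p ∘ φ) (Set.Iic h) + eVariationOn (q ∘ ψ) (Set.Ici h) := by
    rw [hu, eVariationOn.union _ isGreatest_Iic isLeast_Ici, eVariationOn.congr hp,
      eVariationOn.congr hq]
  rw [hsum]
  exact add_le_add
    (eVariationOn.comp_le_of_monotoneOn _ _ (hφ.monotoneOn _) (Set.mapsTo_univ _ _))
    (eVariationOn.comp_le_of_monotoneOn _ _ (hψ.monotoneOn _) (Set.mapsTo_univ _ _))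

lemma eVariationOn_path_symm_le (p : Path x y) :
    eVariationOn p.symm Set.univ ≤ eVariationOn p Set.univ :=
  eVariationOn.comp_le_of_antitoneOn p unitInterval.symm
    (fun _ _ _ _ h => unitInterval.symm_le_symm.2 h) (Set.mapsTo_univ _ _)

lemma eVariationOn_path_refl (x : M) : eVariationOn (Path.refl x) Set.univ = 0 :=
  eVariationOn.constant_on (by
    rintro _ ⟨s, -, rfl⟩ _ ⟨t, -, rfl⟩
    rfl)

lemma minLoopLength_le (γ : Path x x) : minLoopLength (loopClass γ) ≤ loopLength γ :=
  iInf_le_of_le x (iInf_le_of_le γ (iInf_le _ rfl))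

lemma exists_loopLength_lt {a : integralH1 M} {r : ℝ≥0∞} (h : minLoopLength a < r) :
    ∃ (x : M) (γ : Path x x), loopClass γ = a ∧ loopLength γ < r := by
  simpa only [minLoopLength, iInf_lt_iff, exists_prop] using h

lemma le_minLoopLength {a : integralH1 M} {r : ℝ≥0∞}
    (h : ∀ (x : M) (γ : Path x x), loopClass γ = a → r ≤ loopLength γ) : r ≤ minLoopLength a :=
  le_iInf fun x => le_iInf fun γ => le_iInf fun hγ => h x γ hγ

lemma minLoopLength_neg (a : integralH1 M) : minLoopLength (-a) = minLoopLength a := by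
  have h : ∀ b : integralH1 M, minLoopLength (-b) ≤ minLoopLength b := by
    refine fun b => le_minLoopLength fun x γ hγ => ?_
    rw [← hγ, ← loopClass_symm]
    exact (minLoopLength_le _).trans (eVariationOn_path_symm_le γ)
  exact (h a).antisymm (by simpa using h (-a))

lemma minLoopLength_zero [Nonempty M] : minLoopLength (0 : integralH1 M) = 0 := by
  obtain ⟨x⟩ := ‹Nonempty M›
  rw [← loopClass_refl x]
  exact le_zero_iff.1 ((minLoopLength_le _).trans (eVariationOn_path_refl x).le)

lemma minLoopLength_nsmul_le [Nonempty M] (n : ℕ) (a : integralH1 M) :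
    minLoopLength (n • a) ≤ n * minLoopLength a := by
  rcases Nat.eq_zero_or_pos n with rfl | hn
  · simp [minLoopLength_zero]
  have hn' : (n : ℝ≥0∞) ≠ 0 := by exact_mod_cast hn.ne'
  rw [mul_comm, ← ENNReal.div_le_iff_le_mul (Or.inl hn') (Or.inl (ENNReal.natCast_ne_top n))]
  refine le_minLoopLength fun x γ hγ => ?_
  rw [ENNReal.div_le_iff_le_mul (Or.inl hn') (Or.inl (ENNReal.natCast_ne_top n)), mul_comm]
  obtain ⟨δ, hδ, hlen⟩ : ∃ δ : Path x x, loopClass δ = n • a ∧ loopLength δ ≤ n * loopLength γ := by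
    clear hn hn'
    induction n with
    | zero => exact ⟨Path.refl x, by simp [loopClass_refl],
        (eVariationOn_path_refl x).le.trans zero_le⟩
    | succ n ih =>
      obtain ⟨δ, hδ, hlen⟩ := ih
      refine ⟨δ.trans γ, by rw [loopClass_trans, hδ, hγ, succ_nsmul], ?_⟩
      refine (eVariationOn_path_trans_le δ γ).trans ?_
      rw [Nat.cast_succ, add_mul, one_mul]
      exact add_le_add hlen le_rfl
  rw [← hδ]
  exact (minLoopLength_le δ).trans hlen

/-- Run `γ`, then `p`, `δ` and `p` reversed: the two passes through `p` cost `2 * D` and cancel in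
homology. -/
lemma minLoopLength_add_le {D : ℝ≥0∞} (hD : ∀ x y : M, ∃ p : Path x y, eVariationOn p Set.univ ≤ D)
    (a b : integralH1 M) :
    minLoopLength (a + b) ≤ minLoopLength a + minLoopLength b + 2 * D := by
  have h : ∀ (x : M) (γ : Path x x) (y : M) (δ : Path y y), loopClass γ = a → loopClass δ = b →
      minLoopLength (a + b) ≤ loopLength γ + loopLength δ + 2 * D := by
    intro x γ y δ hγ hδ
    obtain ⟨p, hp⟩ := hD x y
    have hc : loopClass (γ.trans ((p.trans δ).trans p.symm)) = a + b := by
      apply homologyToChains_injective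
      rw [← hγ, ← hδ]
      simp only [map_add, homologyToChains_loopClass, pathClass_trans, pathClass_symm]
      abel
    rw [← hc]
    refine (minLoopLength_le _).trans ((eVariationOn_path_trans_le _ _).trans ?_)
    rw [add_assoc]
    refine add_le_add le_rfl ((eVariationOn_path_trans_le _ _).trans ?_)
    refine (add_le_add ((eVariationOn_path_trans_le _ _).trans (add_le_add hp le_rfl))
      ((eVariationOn_path_symm_le p).trans hp)).trans_eq ?_
    rw [two_mul, add_comm D, add_assoc]
    rfl
  simp only [minLoopLength, ENNReal.iInf_add, ENNReal.add_iInf] at h ⊢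
  exact le_iInf fun y => le_iInf fun δ => le_iInf fun hδ => le_iInf fun x => le_iInf fun γ =>
    le_iInf fun hγ => h _ _ _ _ ‹_› ‹_›

/-- A space in which any two points at distance less than `r` are joined by a path of length less
than `r`, for all `r`. -/
def HasShortPaths (M : Type*) [EMetricSpace M] : Prop :=
  ∀ (x y : M) (r : ℝ≥0∞), edist x y < r → ∃ p : Path x y, eVariationOn p Set.univ < r

/-- The classes of the paths in balls of radius `r` only depend on their end points. -/
def PathClassTrivialAtScale (M : Type u) [EMetricSpace M] (r : ℝ≥0∞) : Prop :=
  ∀ (x : M) {y z : M} (p q : Path y z), (∀ t, p t ∈ Metric.eball x r) →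
      (∀ t, q t ∈ Metric.eball x r) → pathClass p = pathClass q

lemma edist_source_le_eVariationOn (p : Path x y) (t : unitInterval) :
    edist (p t) x ≤ eVariationOn p Set.univ := by
  simpa using eVariationOn.edist_le p (Set.mem_univ t) (Set.mem_univ 0)

lemma edist_target_le_eVariationOn (p : Path x y) (t : unitInterval) :
    edist (p t) y ≤ eVariationOn p Set.univ := by
  simpa using eVariationOn.edist_le p (Set.mem_univ t) (Set.mem_univ 1)

/-- Replaceability of `p` between two parameters is symmetric, transitive and, by `hloc`, true for
nearby parameters; connectedness of the interval extends it to `0` and `1`. -/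
lemma exists_rectifiable_path (hM : HasShortPaths M) {r : ℝ≥0∞} (hr : 0 < r)
    (hloc : PathClassTrivialAtScale M r) (p : Path x y) :
    ∃ q : Path x y, eVariationOn q Set.univ ≠ ⊤ ∧ pathClass q = pathClass p := by
  let R : unitInterval → unitInterval → Prop := fun a b =>
    ∃ q : Path (p a) (p b), eVariationOn q Set.univ ≠ ⊤ ∧ pathClass q = pathClass (p.subpath a b)
  have h01 : R 0 1 := by
    refine isPreconnected_univ.induction₂ R (fun a _ => ?_) (fun a b c _ _ _ => ?_)
      (fun a b _ _ => ?_) (Set.mem_univ _) (Set.mem_univ _)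
    · rw [nhdsWithin_univ]
      obtain ⟨ε, hε, hball⟩ := Metric.mem_nhds_iff.1
        (p.continuous.continuousAt.preimage_mem_nhds (Metric.eball_mem_nhds (p a) hr))
      filter_upwards [Metric.ball_mem_nhds a hε] with b hb
      have hin : ∀ c ∈ Set.uIcc a b, p c ∈ Metric.eball (p a) r := by
        intro c hc
        refine hball (lt_of_le_of_lt (b := dist b a) ?_ hb)
        have hc' : (c : ℝ) ∈ Set.uIcc (a : ℝ) b := by
          rcases le_total a b with h | h
          · rw [Set.uIcc_of_le h] at hc
            rw [Set.uIcc_of_le (Subtype.coe_le_coe.2 h)]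
            exact hc
          · rw [Set.uIcc_of_ge h] at hc
            rw [Set.uIcc_of_ge (Subtype.coe_le_coe.2 h)]
            exact hc
        exact Set.abs_sub_left_of_mem_uIcc hc'
      obtain ⟨q, hq⟩ := hM (p a) (p b) r (by
        rw [edist_comm]
        exact hin b Set.right_mem_uIcc)
      refine ⟨q, hq.ne_top, hloc (p a) _ _
        (fun t => (edist_source_le_eVariationOn q t).trans_lt hq) fun t => ?_⟩
      obtain ⟨c, hc, h⟩ := (p.range_subpath a b).subset (Set.mem_range_self t)
      rw [← h]
      exact hin c hc
    · rintro ⟨q, hq, hqc⟩ ⟨q', hq', hqc'⟩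
      refine ⟨q.trans q', ((eVariationOn_path_trans_le q q').trans_lt
        (ENNReal.add_lt_top.2 ⟨hq.lt_top, hq'.lt_top⟩)).ne, ?_⟩
      rw [pathClass_trans, hqc, hqc', pathClass_subpath_add]
    · rintro ⟨q, hq, hqc⟩
      refine ⟨q.symm, ((eVariationOn_path_symm_le q).trans_lt hq.lt_top).ne, ?_⟩
      rw [pathClass_symm, hqc, ← pathClass_symm, Path.symm_subpath]
  obtain ⟨q, hq, hqc⟩ := h01
  refine ⟨q.cast p.source.symm p.target.symm, hq, ?_⟩
  rw [← pathClass_subpath_zero_one p, ← hqc]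
  rfl

lemma minLoopLength_ne_top [PathConnectedSpace M] (hM : HasShortPaths M) {r : ℝ≥0∞} (hr : 0 < r)
    (hloc : PathClassTrivialAtScale M r) (a : integralH1 M) : minLoopLength a ≠ ⊤ := by
  obtain ⟨x⟩ := (inferInstance : Nonempty M)
  obtain ⟨γ, rfl⟩ := exists_loopClass_eq x a
  obtain ⟨δ, hδ, hc⟩ := exists_rectifiable_path hM hr hloc γ
  have : loopClass γ = loopClass δ := by
    apply homologyToChains_injective
    rw [homologyToChains_loopClass, homologyToChains_loopClass, hc]
  rw [this]
  exact ((minLoopLength_le δ).trans_lt hδ.lt_top).ne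

end Length

/-! ### Homomorphisms to the reals are bounded by length -/

section LowerBound

variable {M : Type u} [EMetricSpace M] {x y : M}

lemma exists_finite_net (M : Type*) [EMetricSpace M] [CompactSpace M] {ρ : ℝ≥0∞} (hρ : 0 < ρ) :
    ∃ P : Finset M, ∀ x : M, ∃ p ∈ P, edist p x < ρ := by
  obtain ⟨t, -, ht⟩ := (isCompact_univ (X := M)).elim_nhds_subcover
    (fun x => Metric.eball x ρ) (fun x _ => Metric.eball_mem_nhds x hρ)
  refine ⟨t, fun x => ?_⟩
  obtain ⟨p, hp, hx⟩ := Set.mem_iUnion₂.1 (ht (Set.mem_univ x))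
  exact ⟨p, hp, by rw [edist_comm]; exact hx⟩

/-- If small pieces of paths have bounded `Φ`-class, up to a coboundary `τ`, then the `Φ`-class of
a path is bounded linearly in its length. -/
lemma abs_pathClass_le_of_eVariationOn_lt
    (Φ : ((integralSingularChains M).opcycles 1 : AddCommGrpCat.{u}) →+ ℝ) (τ : M → ℝ) {C : ℝ}
    (hC : 0 ≤ C) {ρ : ℝ≥0} (hρ : 0 < ρ)
    (h : ∀ (x y : M) (g : Path x y), (∀ t, edist x (g t) ≤ ρ) →
      |τ x + Φ (pathClass g) - τ y| ≤ C) (p : Path x y) (n : ℕ) :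
    ∀ t : unitInterval, eVariationOn p (Set.Icc t 1) < n * ρ →
      |τ (p t) + Φ (pathClass (p.subpath t 1)) - τ (p 1)| ≤ n * C := by
  have hsub : ∀ a b : unitInterval, a ≤ b → (∀ s ∈ Set.Icc a b, edist (p a) (p s) ≤ ρ) →
      |τ (p a) + Φ (pathClass (p.subpath a b)) - τ (p b)| ≤ C := by
    intro a b hab hs
    refine h _ _ _ fun t => ?_
    obtain ⟨c, hc, hct⟩ := (p.range_subpath a b).subset (Set.mem_range_self t)
    rw [← hct]
    exact hs c (by rwa [Set.uIcc_of_le hab] at hc)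
  induction n with
  | zero => intro t ht; simp at ht
  | succ n ih =>
    intro t ht
    by_cases hall : ∀ s ∈ Set.Icc t 1, edist (p t) (p s) ≤ ρ
    · refine (hsub t 1 t.2.2 hall).trans ?_
      push_cast
      nlinarith [(Nat.cast_nonneg n : (0 : ℝ) ≤ n)]
    push Not at hall
    obtain ⟨s₁, hs₁, hs₁ρ⟩ := hall
    have hcont : Continuous fun s => edist (p t) (p s) := continuous_const.edist p.continuous
    -- The least element `s` of `A` is the first parameter where the distance from `p t` reaches
    -- `ρ`. The piece up to `s` uses up length at least `ρ`, which pays for one induction step.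
    let A : Set unitInterval := Set.Icc t 1 ∩ {s | (ρ : ℝ≥0∞) ≤ edist (p t) (p s)}
    have hA : IsCompact A := isCompact_Icc.inter_right (isClosed_le continuous_const hcont)
    obtain ⟨s, ⟨hs, hsρ⟩, hmin⟩ := hA.exists_isLeast ⟨s₁, hs₁, hs₁ρ.le⟩
    have hts : t ≠ s := by
      rintro rfl
      rw [Set.mem_ofPred_eq, edist_self] at hsρ
      exact hρ.ne' (by simpa using hsρ)
    have hle : Set.Icc t s ⊆ {u | edist (p t) (p u) ≤ ρ} := by
      rw [← closure_Ico hts]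
      refine closure_minimal (fun u hu => ?_) (isClosed_le hcont continuous_const)
      change edist (p t) (p u) ≤ ρ
      by_contra hlt
      exact hu.2.not_ge (hmin ⟨⟨hu.1, u.2.2⟩, (not_le.1 hlt).le⟩)
    have hvar : eVariationOn p (Set.Icc s 1) < n * ρ := by
      have hadd := eVariationOn.Icc_add_Icc p (s := Set.univ) hs.1 hs.2 (Set.mem_univ s)
      simp only [Set.univ_inter] at hadd
      have h1 : (ρ : ℝ≥0∞) ≤ eVariationOn p (Set.Icc t s) :=
        le_trans hsρ (eVariationOn.edist_le p (Set.left_mem_Icc.2 hs.1) (Set.right_mem_Icc.2 hs.1))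
      have h2 : (ρ : ℝ≥0∞) + eVariationOn p (Set.Icc s 1) < ρ + n * ρ := by
        refine lt_of_le_of_lt (add_le_add h1 le_rfl) ?_
        rw [hadd]
        refine ht.trans_eq ?_
        push_cast
        ring
      exact lt_of_add_lt_add_left h2
    have h1 := hsub t s hs.1 hle
    have h2 := ih s hvar
    rw [← pathClass_subpath_add p t s 1, map_add]
    have h3 := abs_add_le (τ (p t) + Φ (pathClass (p.subpath t s)) - τ (p s))
      (τ (p s) + Φ (pathClass (p.subpath s 1)) - τ (p 1))
    rw [show τ (p t) + Φ (pathClass (p.subpath t s)) - τ (p s) +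
      (τ (p s) + Φ (pathClass (p.subpath s 1)) - τ (p 1)) = τ (p t) +
      (Φ (pathClass (p.subpath t s)) + Φ (pathClass (p.subpath s 1))) - τ (p 1) by ring] at h3
    push_cast
    linarith

/-- Connecting both ends of a short path to nearby points of a finite net gives a path inside a ball
of radius `r`, whose class depends only on the two net points. Only finitely many values occur, and
`τ` records `Φ` of the connecting paths. -/
lemma exists_coboundary_bound [CompactSpace M] (hM : HasShortPaths M) {r : ℝ≥0∞} (hr : 0 < r)
    (hloc : PathClassTrivialAtScale M r)
    (Φ : ((integralSingularChains M).opcycles 1 : AddCommGrpCat.{u}) →+ ℝ) :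
    ∃ (τ : M → ℝ) (C : ℝ) (ρ : ℝ≥0), 0 ≤ C ∧ 0 < ρ ∧ ∀ (x y : M) (g : Path x y),
      (∀ t, edist x (g t) ≤ ρ) → |τ x + Φ (pathClass g) - τ y| ≤ C := by
  -- Seen from `c x`, the path `g` stays within `2 * ρ` and `σ y` within `3 * ρ`, so `4 * ρ < r`
  -- suffices.
  obtain ⟨ρ, hρ, hρr⟩ : ∃ ρ : ℝ≥0, 0 < ρ ∧ 4 * (ρ : ℝ≥0∞) < r := by
    obtain ⟨s, hs0, hsr⟩ := ENNReal.lt_iff_exists_nnreal_btwn.1 hr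
    refine ⟨s / 4, by have := ENNReal.coe_pos.1 hs0; positivity, ?_⟩
    have h4 : (4 : ℝ≥0∞) = ((4 : ℝ≥0) : ℝ≥0∞) := rfl
    rwa [h4, ← ENNReal.coe_mul, mul_div_cancel₀ _ four_ne_zero]
  have hρ' : (0 : ℝ≥0∞) < ρ := ENNReal.coe_pos.2 hρ
  obtain ⟨P, hP⟩ := exists_finite_net M hρ'
  choose c hcP hc using hP
  choose σ hσ using fun x => hM (c x) x ρ (hc x)
  have hκ : ∀ a b : M, ∃ k : ℝ, 0 ≤ k ∧ ∀ s : Path a b, (∀ t, s t ∈ Metric.eball a r) →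
      |Φ (pathClass s)| ≤ k := by
    intro a b
    by_cases h : ∃ s : Path a b, ∀ t, s t ∈ Metric.eball a r
    · obtain ⟨s, hs⟩ := h
      exact ⟨|Φ (pathClass s)|, abs_nonneg _, fun s' hs' => by rw [hloc a s' s hs' hs]⟩
    · exact ⟨0, le_rfl, fun s hs => absurd ⟨s, hs⟩ h⟩
  choose κ hκ0 hκ using hκ
  refine ⟨fun x => Φ (pathClass (σ x)), ∑ a ∈ P, ∑ b ∈ P, κ a b, ρ,
    Finset.sum_nonneg fun a _ => Finset.sum_nonneg fun b _ => hκ0 a b, hρ, fun x y g hg => ?_⟩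
  have hcg : ∀ t, edist (g t) (c x) ≤ 2 * ρ := by
    intro t
    refine (edist_triangle_right _ _ x).trans ?_
    rw [two_mul, edist_comm]
    exact add_le_add (hg t) (hc x).le
  have h42 : 2 * (ρ : ℝ≥0∞) + (ρ + ρ) = 4 * ρ := by ring
  have hball : ∀ t, ((σ x).trans (g.trans (σ y).symm)) t ∈ Metric.eball (c x) r := by
    have h1 : Set.range (σ x) ⊆ Metric.eball (c x) r := by
      rintro _ ⟨t, rfl⟩
      refine (((edist_source_le_eVariationOn _ t).trans_lt (hσ x)).trans_le ?_).trans hρr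
      rw [← h42, ← add_assoc]
      exact le_add_self
    have h2 : Set.range g ⊆ Metric.eball (c x) r := by
      rintro _ ⟨t, rfl⟩
      refine ((hcg t).trans ?_).trans_lt hρr
      rw [← h42]
      exact le_self_add
    have h3 : Set.range (σ y) ⊆ Metric.eball (c x) r := by
      rintro _ ⟨t, rfl⟩
      refine lt_of_le_of_lt ((edist_triangle _ y _).trans ?_) hρr
      have hy := hcg 1
      rw [g.target] at hy
      have h4 := ((edist_target_le_eVariationOn (σ y) t).trans (hσ y).le)
      rw [← h42, add_comm]
      exact add_le_add hy (h4.trans le_self_add)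
    have hrange : Set.range ((σ x).trans (g.trans (σ y).symm)) ⊆ Metric.eball (c x) r := by
      rw [Path.trans_range, Path.trans_range, Path.symm_range]
      exact Set.union_subset h1 (Set.union_subset h2 h3)
    exact fun t => hrange (Set.mem_range_self t)
  have h := hκ (c x) (c y) _ hball
  rw [pathClass_trans, pathClass_trans, pathClass_symm, map_add, map_add, map_neg, ← add_assoc,
    ← sub_eq_add_neg] at h
  refine h.trans ?_
  exact (Finset.single_le_sum (f := fun b => κ (c x) b) (fun b _ => hκ0 _ b) (hcP y)).trans
    (Finset.single_le_sum (f := fun a => ∑ b ∈ P, κ a b)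
      (fun a _ => Finset.sum_nonneg fun b _ => hκ0 a b) (hcP x))

lemma exists_abs_le_minLoopLength [CompactSpace M] (hM : HasShortPaths M) {r : ℝ≥0∞} (hr : 0 < r)
    (hloc : PathClassTrivialAtScale M r) (hfin : ∀ a : integralH1 M, minLoopLength a ≠ ⊤)
    (φ : integralH1 M →+ ℝ) :
    ∃ K : ℝ, ∀ a, |φ a| ≤ K * ((minLoopLength a).toReal + 2) := by
  obtain ⟨Φ, hΦ⟩ := (Module.Baer.of_divisible ℝ).extension_property_addMonoidHom
    (homologyToChains M) (homologyToChains_injective M) φ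
  obtain ⟨τ, C, ρ, hC, hρ, h⟩ := exists_coboundary_bound hM hr hloc Φ
  have hρ' : (0 : ℝ) < ρ := hρ
  -- A loop of length at most `l + 1` needs at most `(l + 1) / ρ + 1` pieces, each costing `C`; the
  -- total is at most `(C / ρ + C) * (l + 2)`.
  refine ⟨C / ρ + C, fun a => ?_⟩
  obtain ⟨x, γ, rfl, hγ⟩ := exists_loopLength_lt (ENNReal.lt_add_right (hfin a) one_ne_zero)
  set l := (minLoopLength (loopClass γ)).toReal
  have hl0 : 0 ≤ l := ENNReal.toReal_nonneg
  have hγ' : loopLength γ ≠ ⊤ := hγ.ne_top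
  have hlen : (loopLength γ).toReal ≤ l + 1 := by
    have := ENNReal.toReal_mono (ENNReal.add_ne_top.2 ⟨hfin _, ENNReal.one_ne_top⟩) hγ.le
    rwa [ENNReal.toReal_add (hfin _) ENNReal.one_ne_top, ENNReal.toReal_one] at this
  let n := ⌊(loopLength γ).toReal / ρ⌋₊ + 1
  have hn : eVariationOn γ (Set.Icc 0 1) < n * ρ := by
    refine (eVariationOn.mono γ (Set.subset_univ _)).trans_lt ?_
    change loopLength γ < _
    have : (n : ℝ≥0∞) * ρ = ((n * ρ : ℝ≥0) : ℝ≥0∞) := by simp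
    rw [this, ← ENNReal.coe_toNNReal hγ', ENNReal.coe_lt_coe, ← NNReal.coe_lt_coe]
    have h1 := (div_lt_iff₀ hρ').1 (Nat.lt_floor_add_one ((loopLength γ).toReal / ρ))
    simp only [n]
    push_cast
    exact h1
  have hmain := abs_pathClass_le_of_eVariationOn_lt Φ τ hC hρ h γ n 0 hn
  rw [pathClass_subpath_zero_one, γ.source, γ.target, add_sub_cancel_left,
    ← homologyToChains_loopClass, ← AddMonoidHom.comp_apply, hΦ] at hmain
  refine hmain.trans ?_
  have hn' : (n : ℝ) ≤ (l + 1) / ρ + 1 := by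
    have h1 := Nat.floor_le (div_nonneg (ENNReal.toReal_nonneg (a := loopLength γ)) hρ'.le)
    have h2 := div_le_div_of_nonneg_right hlen hρ'.le
    simp only [n]
    push_cast
    linarith
  refine (mul_le_mul_of_nonneg_right hn' hC).trans ?_
  have h3 : 0 ≤ C / ρ := by positivity
  have h4 : ((l + 1) / ρ + 1) * C = C / ρ * (l + 1) + C := by ring
  rw [h4]
  nlinarith

end LowerBound

/-! ### The stable norm -/

section StableNorm

variable {M : Type u} [EMetricSpace M]

/-- The stable length of homology classes exists, provided that the lengths of the shortest loops
are finite and subadditive up to a constant. -/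
lemma exists_tendsto_minLoopLength_div {B : ℝ} (hB : ∀ a b : integralH1 M,
      (minLoopLength (a + b)).toReal ≤ (minLoopLength a).toReal + (minLoopLength b).toReal + B)
    (a : integralH1 M) :
    ∃ v : ℝ≥0, Tendsto (fun n : ℕ => (minLoopLength (n • a)).toReal / n) atTop (𝓝 (v : ℝ)) := by
  -- Adding `B` to each term absorbs the defect of subadditivity; `B / n` tends to `0` and does not
  -- affect the limit.
  have hsub : Subadditive fun n : ℕ => (minLoopLength (n • a)).toReal + B := by
    intro m n
    have := hB (m • a) (n • a)
    rw [← add_nsmul] at this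
    linarith
  have hlow : BddBelow (Set.range fun n : ℕ => ((minLoopLength (n • a)).toReal + B) / n) := by
    refine ⟨-|B|, ?_⟩
    rintro _ ⟨n, rfl⟩
    simp only
    rcases Nat.eq_zero_or_pos n with rfl | hn
    · simp
    have hn1 : (1 : ℝ) ≤ n := by exact_mod_cast hn
    rw [le_div_iff₀ (by linarith)]
    have h1 : 0 ≤ (minLoopLength (n • a)).toReal := ENNReal.toReal_nonneg
    nlinarith [neg_abs_le B, abs_nonneg B]
  have hlim := hsub.tendsto_lim hlow
  have hB0 : Tendsto (fun n : ℕ => B / (n : ℝ)) atTop (𝓝 0) :=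
    tendsto_const_div_atTop_nhds_zero_nat B
  have hlim' := hlim.sub hB0
  simp only [← sub_div, add_sub_cancel_right, sub_zero] at hlim'
  exact ⟨⟨hsub.lim, ge_of_tendsto' hlim' fun n => by positivity⟩, hlim'⟩

end StableNorm

lemma HasShortPaths.pathConnectedSpace {M : Type*} [EMetricSpace M] (hM : HasShortPaths M)
    [ConnectedSpace M] : PathConnectedSpace M where
  nonempty := inferInstance
  joined x y := (hM x y ⊤ (edist_lt_top_of_preconnectedSpace x y)).nonempty

section StableNorm

variable {M : Type u} [EMetricSpace M] [Nonempty M]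

lemma isNatSublinear_of_tendsto {B : ℝ}
    (hB : ∀ a b : integralH1 M,
      (minLoopLength (a + b)).toReal ≤ (minLoopLength a).toReal + (minLoopLength b).toReal + B)
    {ν : integralH1 M → ℝ}
    (hν : ∀ a, Tendsto (fun n : ℕ => (minLoopLength (n • a)).toReal / n) atTop (𝓝 (ν a))) :
    IsNatSublinear ν where
  add_le a b := by
    have hB0 : Tendsto (fun n : ℕ => B / (n : ℝ)) atTop (𝓝 0) :=
      tendsto_const_div_atTop_nhds_zero_nat B
    have h := ((hν a).add (hν b)).add hB0
    rw [add_zero] at h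
    refine le_of_tendsto_of_tendsto' (hν (a + b)) h fun n => ?_
    rw [← add_div, ← add_div, nsmul_add]
    exact div_le_div_of_nonneg_right (hB _ _) n.cast_nonneg
  nsmul k a := by
    rcases Nat.eq_zero_or_pos k with rfl | hk
    · refine tendsto_nhds_unique (hν _) ?_
      simp [minLoopLength_zero]
    · have hk' : (k : ℝ) ≠ 0 := by exact_mod_cast hk.ne'
      -- Homogeneity: the sequence for `k • a` is `k` times the subsequence of the one for `a` along
      -- multiples of `k`.
      have h := ((hν a).comp (tendsto_id.atTop_mul_const' hk)).const_mul (k : ℝ)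
      refine tendsto_nhds_unique (hν _) (h.congr fun n => ?_)
      simp only [Function.comp_apply, id, mul_smul]
      push_cast
      field_simp

end StableNorm

theorem mainTheorem8 {d : ℕ} {M : Type u} [EMetricSpace M]
    [ChartedSpace (EuclideanSpace ℝ (Fin d)) M] [IsManifold (𝓡 d) ∞ M]
    [RiemannianBundle (fun x : M => TangentSpace (𝓡 d) x)]
    [IsContMDiffRiemannianBundle (𝓡 d) ∞ (EuclideanSpace ℝ (Fin d))
      (fun x : M => TangentSpace (𝓡 d) x)]
    [IsRiemannianManifold (𝓡 d) M] [CompactSpace M] [ConnectedSpace M] :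
    (∀ a : integralH1 M, minLoopLength a ≠ ⊤) ∧
    ∃ ν : integralH1 M → ℝ≥0,
      (∀ a : integralH1 M,
        Tendsto (fun n : ℕ => minLoopLength (n • a) / (n : ℝ≥0∞)) atTop (𝓝 (ν a : ℝ≥0∞))) ∧
      (∀ a : integralH1 M, ν a = 0 ↔ IsOfFinAddOrder a) ∧
      (∀ (a : integralH1 M) (n : ℤ), (ν (n • a) : ℝ) = |(n : ℝ)| * ν a) ∧
      (∀ a b : integralH1 M, ν (a + b) ≤ ν a + ν b) ∧
      (∀ a : integralH1 M, (ν a : ℝ≥0∞) ≤ minLoopLength a) ∧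
      ∃! N : Seminorm ℝ (ℝ ⊗[ℤ] integralH1 M),
        (∀ x, N x = 0 → x = 0) ∧
        ∀ (t : ℝ) (a : integralH1 M), N (t ⊗ₜ[ℤ] a) = |t| * ν a := by
  have hM : HasShortPaths M := fun x y r h => exists_path_eVariationOn_lt (I := 𝓡 d) h
  obtain ⟨r, hr, hloc⟩ := exists_radius_pathClass_eq (EuclideanSpace ℝ (Fin d)) M
  have := hM.pathConnectedSpace
  have hfin : ∀ a : integralH1 M, minLoopLength a ≠ ⊤ := minLoopLength_ne_top hM hr hloc
  obtain ⟨D, hD⟩ := exists_edist_le_of_compactSpace M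
  -- Short paths are given only for lengths strictly above the distance, hence `D + 1`.
  have hD' : ∀ x y : M, ∃ p : Path x y, eVariationOn p Set.univ ≤ D + 1 := fun x y =>
    (hM x y (D + 1) ((hD x y).trans_lt
      (ENNReal.lt_add_right ENNReal.coe_ne_top one_ne_zero))).imp fun _ h => h.le
  have hB : ∀ a b : integralH1 M, (minLoopLength (a + b)).toReal ≤
      (minLoopLength a).toReal + (minLoopLength b).toReal + (2 * ((D : ℝ≥0∞) + 1)).toReal := by
    intro a b
    have h2 : 2 * ((D : ℝ≥0∞) + 1) ≠ ⊤ := by finiteness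
    rw [← ENNReal.toReal_add (hfin a) (hfin b),
      ← ENNReal.toReal_add (ENNReal.add_ne_top.2 ⟨hfin a, hfin b⟩) h2]
    exact ENNReal.toReal_mono (ENNReal.add_ne_top.2 ⟨ENNReal.add_ne_top.2 ⟨hfin a, hfin b⟩, h2⟩)
      (minLoopLength_add_le hD' a b)
  choose ν hν using exists_tendsto_minLoopLength_div hB
  have hsub : IsNatSublinear fun a => (ν a : ℝ) := isNatSublinear_of_tendsto hB hν
  have hneg : ∀ a, (ν (-a) : ℝ) = ν a := fun a =>
    tendsto_nhds_unique (hν (-a)) (by simpa only [smul_neg, minLoopLength_neg] using hν a)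
  have hle : ∀ a, (ν a : ℝ≥0∞) ≤ minLoopLength a := by
    intro a
    rw [← ENNReal.coe_toNNReal (hfin a), ENNReal.coe_le_coe, ← NNReal.coe_le_coe]
    refine le_of_tendsto' (hν a) fun n => ?_
    have h := ENNReal.toReal_mono (ENNReal.mul_ne_top (ENNReal.natCast_ne_top n) (hfin a))
      (minLoopLength_nsmul_le n a)
    rw [ENNReal.toReal_mul, ENNReal.toReal_natCast, mul_comm] at h
    exact div_le_of_le_mul₀ n.cast_nonneg NNReal.zero_le_coe h
  have hdom : ∀ φ : integralH1 M →+ ℝ, ∃ C : ℝ, ∀ a, |φ a| ≤ C * ν a := by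
    intro φ
    obtain ⟨K, h⟩ := exists_abs_le_minLoopLength hM hr hloc hfin φ
    refine ⟨K, fun a => ?_⟩
    -- The bound for `n • a`, divided by `n`: the constant `2` disappears in the limit.
    have hlim := ((hν a).add (tendsto_const_div_atTop_nhds_zero_nat (2 : ℝ))).const_mul K
    rw [add_zero] at hlim
    refine ge_of_tendsto hlim ?_
    filter_upwards [eventually_gt_atTop 0] with n hn
    have hn' : (0 : ℝ) < n := by exact_mod_cast hn
    have := h (n • a)
    rw [map_nsmul, nsmul_eq_mul, abs_mul, Nat.abs_cast] at this
    rw [← add_div, ← mul_div_assoc, le_div_iff₀ hn', mul_comm]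
    exact this
  obtain ⟨N, hN0, hN⟩ := exists_norm_extension hsub hneg hdom
  refine ⟨hfin, ν, fun a => ?_, fun a => ⟨fun h => ?_, fun h => ?_⟩, fun a n => ?_, hsub.add_le,
    hle, N, ⟨hN0, hN⟩, fun N' hN' => norm_extension_unique hN'.2 hN⟩
  · have h := (ENNReal.continuous_ofReal.tendsto _).comp (hν a)
    rw [ENNReal.ofReal_coe_nnreal] at h
    refine h.congr' ?_
    filter_upwards [eventually_gt_atTop 0] with n hn
    have hn' : (0 : ℝ) < n := by exact_mod_cast hn
    rw [Function.comp_apply, ENNReal.ofReal_div_of_pos hn', ENNReal.ofReal_toReal (hfin _),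
      ENNReal.ofReal_natCast]
  · by_contra ha
    obtain ⟨φ, hφ⟩ := exists_addMonoidHom_real_ne_zero ha
    obtain ⟨C, hC⟩ := hdom φ
    have := hC a
    rw [h, NNReal.coe_zero, mul_zero] at this
    exact hφ (abs_nonpos_iff.1 this)
  · obtain ⟨k, hk, hka⟩ := isOfFinAddOrder_iff_nsmul_eq_zero.1 h
    have h1 := hsub.nsmul k a
    rw [hka, hsub.zero] at h1
    have hk' : (k : ℝ) ≠ 0 := by exact_mod_cast hk.ne'
    exact NNReal.coe_eq_zero.1 ((mul_eq_zero.1 h1.symm).resolve_left hk')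
  · obtain ⟨k, rfl | rfl⟩ := n.eq_nat_or_neg
    · rw [natCast_zsmul, hsub.nsmul k a]
      simp
    · rw [neg_smul, hneg, natCast_zsmul, hsub.nsmul k a]
      simp
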